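/- Let $\mathcal{C}_0$ be a Barr exact category (a regular category with finite limits in which every internal equivalence relation is a kernel pair). Let $\mathsf{Arr}^0(\mathcal{C}_0)=\mathcal{C}_0$ and let $\mathsf{Arr}^{n+1}(\mathcal{C}_0)$ be the category of arrows of $\mathsf{Arr}^{n}(\mathcal{C}_0)$. Let $\mathcal{E}_1$ be the class of regular epimorphisms of $\mathcal{C}_0$. For $n\geq 1$, let $\mathcal{E}_{n+1}$ be the class of those morphisms $\alpha\colon f_A\to f_B$ of $\mathsf{Arr}^{n}(\mathcal{C}_0)$, viewed as commutative squares in $\mathsf{Arr}^{n-1}(\mathcal{C}_0)$ with top side $\alpha_\top\colon A_\top\to B_\top$, bottom side $\alpha_\perp\colon A_\perp\to B_\perp$ and vertical sides $f_A\colon A_\top\to A_\perp$ and $f_B\colon B_\top\to B_\perp$, for which $f_A$, $f_B$, $\alpha_\top$, $\alpha_\perp$, both projections of the pullback $A_\perp\times_{B_\perp}B_\top$ and the comparison map $A_\top\to A_\perp\times_{B_\perp}B_\top$ all belong to $\mathcal{E}_n$. The elements of $\mathcal{E}_n$ are called $n$-fold extensions. For $n\geq 1$, let $\mathcal{C}_n$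 be the full subcategory of $\mathsf{Arr}^n(\mathcal{C}_0)$ whose objects are the $n$-fold extensions; then $\mathcal{E}_{n+1}$ may be viewed as a class of morphisms of $\mathcal{C}_n$. For every $n\geq 0$ and every $(n+1)$-fold extension $e\colon E\to B$ in $\mathcal{C}_n$ the following hold. 1. $e$ is of (global) effective descent in $\mathcal{C}_n$: the pullback along $e$ of every morphism of $\mathcal{C}_n$ with codomain $B$ exists in $\mathcal{C}_n$, and the pullback functor $e^*\colon \mathcal{C}_n/B\to\mathcal{C}_n/E$ (right adjoint to composition with $e$) is monadic. 2. $e$ is of effective $\mathcal{E}_{n+1}$-descent in $\mathcal{C}_n$: writing $\mathsf{Ext}(Z)$ for the full subcategory of $\mathcal{C}_n/Z$ whose objects are the morphisms in $\mathcal{E}_{n+1}$ with codomain $Z$, composition with $e$ and pullback along $e$ restrict to functors $\mathsf{Ext}(E)\to\mathsf{Ext}(B)$ and $\mathsf{Ext}(B)\to\mathsf{Ext}(E)$, and the latter is monadic. -/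

import Mathlib

universe v u

open CategoryTheory Limits

namespace HigherExt

/-- A Barr exact category: a regular category (finite limits, coequalisers of kernel pairs,
pullback-stable regular epimorphisms) in which every internal equivalence relation is effective,
that is, is the kernel pair of its coequaliser. -/
class BarrExact (C : Type u) [Category.{v} C] : Prop extends Regular C where
  effective {R X : C} (p₁ p₂ : R ⟶ X) [IsEquivalenceRelation p₁ p₂] :
    IsEffectiveEquivalenceRelation p₁ p₂

section DoubleExtension

variable {Y : Type u} [Category.{v} Y]

/-- A commutative square in `Y`, viewed as a morphism `α : f ⟶ g` of the arrow category, with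
top component `α.left` and bottom component `α.right`, is an `E`-double extension when the pullback
of `α.right` and `g.hom` exists, and the four sides of the square, the two projections `π₁`, `π₂`
of the pullback and the comparison map `p` to the pullback all belong to `E`. -/
def doubleExtension (E : MorphismProperty Y) : MorphismProperty (Arrow Y) :=
  fun f g α =>
    E f.hom ∧ E g.hom ∧ E α.left ∧ E α.right ∧
      ∃ (P : Y) (π₁ : P ⟶ f.right) (π₂ : P ⟶ g.left) (p : f.left ⟶ P),
        IsPullback π₁ π₂ α.right g.hom ∧ p ≫ π₁ = f.hom ∧ p ≫ π₂ = α.left ∧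
          E π₁ ∧ E π₂ ∧ E p

end DoubleExtension

section Tower

variable (C : Type (max u v)) [Category.{v} C]

/-- The tower of higher arrows `Arrⁿ(C)`: `Arr⁰(C) = C` and `Arrⁿ⁺¹(C) = Arr(Arrⁿ(C))`. -/
def HArr : ℕ → Cat.{v, max u v}
  | 0 => Cat.of C
  | n + 1 => Cat.of (Arrow (HArr n))

/-- `extClass C n` is the class `ℰₙ₊₁` of `(n+1)`-fold extensions, a class of morphisms of
`Arrⁿ(C)`: `ℰ₁` consists of the regular epimorphisms of `C`, and `ℰₙ₊₂` of the `ℰₙ₊₁`-double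
extensions. -/
def extClass : (n : ℕ) → MorphismProperty (HArr.{v, u} C n)
  | 0 => MorphismProperty.regularEpi C
  | n + 1 => doubleExtension (extClass n)

/-- The objects of `Arrⁿ(C)` which are `n`-fold extensions (all objects of `C` for `n = 0`). -/
def isExt : (n : ℕ) → ObjectProperty (HArr.{v, u} C n)
  | 0 => fun _ => True
  | n + 1 => fun f : Arrow (HArr.{v, u} C n) => extClass.{v, u} C n f.hom

/-- The `n`-th level `Cₙ = Extⁿ(C)` of the tower of extensions: the full subcategory of `Arrⁿ(C)`
on the `n`-fold extensions. -/
abbrev ExtCat (n : ℕ) : Type (max u v) := (isExt.{v, u} C n).FullSubcategory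

/-- The class `ℰₙ₊₁` of `(n+1)`-fold extensions, as a class of morphisms of `Cₙ`. -/
def ext (n : ℕ) : MorphismProperty (ExtCat.{v, u} C n) :=
  (extClass.{v, u} C n).inverseImage (isExt.{v, u} C n).ι

end Tower

section Descent

variable {Y : Type u} [Category.{v} Y]

/-- `e : X ⟶ B` is of (global) effective descent: pullbacks of arbitrary morphisms along `e` exist,
and the pullback functor `e^* : Y/B ⥤ Y/X`, right adjoint to composition with `e`, is monadic. -/
def IsEffectiveDescent {X B : Y} (e : X ⟶ B) : Prop :=
  ∃ _ : HasPullbacksAlong e, Nonempty (MonadicRightAdjoint (Over.pullback e))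

/-- `e : X ⟶ B` is of effective `E`-descent: writing `E.Over ⊤ B` for the full subcategory of the
slice over `B` on the morphisms in `E`, composition with `e` restricts to
`E.Over ⊤ X ⥤ E.Over ⊤ B`, pullback along `e` exists and restricts to
`e^*| : E.Over ⊤ B ⥤ E.Over ⊤ X`, and `e^*|` is monadic. -/
def IsEffectiveRelDescent (E : MorphismProperty Y) {X B : Y} (e : X ⟶ B) : Prop :=
  (∀ {A : Y} (k : A ⟶ X), E k → E (k ≫ e)) ∧
    ∃ (_ : E.HasPullbacksAlong e) (_ : E.IsStableUnderBaseChangeAlong e),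
      Nonempty (MonadicRightAdjoint (MorphismProperty.Over.pullback E ⊤ e))

end Descent

end HigherExt

/-! The proof isolates the properties of regular epimorphisms that descent requires
(`IsExtensionClass`) and shows that they propagate along the tower. Besides closure under
composition, base change and right cancellation, these say that members of the class are
coequalisers of their kernel pairs and that descent data along them are effective. Three facts carry
the argument.

Base: in a Barr exact category a descent datum is an equivalence relation, and its quotient is the
descended object (`BarrExact.exists_descent`).

Induction: descent data in an arrow category are descended on domains and codomains separately. The
coequaliser property yields the arrow between the two results, and right cancellation puts it in the
class (`IsExtensionClass.arrow`).

Conclusion: the properties restrict to the full subcategory of extensions (`fullSubcategory`). There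
they make the comparison functor into algebras an equivalence, with no appeal to Beck's theorem
(`nonempty_monadicRightAdjoint`). -/

namespace HigherExt

/-! ### A direct criterion for monadicity -/

section Monadicity

universe v₁ v₂ u₁ u₂

variable {A : Type u₁} [Category.{v₁} A] {D : Type u₂} [Category.{v₂} D]
  {L : D ⥤ A} {R : A ⥤ D}

/-- A right adjoint is monadic as soon as each component of the counit is the coequalizer of its
canonical presentation, and each algebra `(M, ξ)` admits an isomorphism `M ≅ R Z` whose transpose
`L M ⟶ Z` coequalizes `L ξ` and the counit. -/
theorem nonempty_monadicRightAdjoint (adj : L ⊣ R)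
    (hepi : ∀ Z : A, Epi (adj.counit.app Z))
    (hdesc : ∀ {Z W : A} (k : L.obj (R.obj Z) ⟶ W),
      L.map (R.map (adj.counit.app Z)) ≫ k = adj.counit.app (L.obj (R.obj Z)) ≫ k →
        ∃ k' : Z ⟶ W, adj.counit.app Z ≫ k' = k)
    (hsurj : ∀ (M : D) (ξ : R.obj (L.obj M) ⟶ M), adj.unit.app M ≫ ξ = 𝟙 M →
      R.map (adj.counit.app (L.obj M)) ≫ ξ = R.map (L.map ξ) ≫ ξ →
        ∃ (Z : A) (i : M ≅ R.obj Z), L.map ξ ≫ L.map i.hom ≫ adj.counit.app Z =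
          adj.counit.app (L.obj M) ≫ L.map i.hom ≫ adj.counit.app Z) :
    Nonempty (MonadicRightAdjoint R) := by
  have hfaith : R.Faithful := by
    have := hepi
    exact adj.faithful_R_of_epi_counit_app
  refine ⟨⟨L, adj, { full := ⟨?_⟩, essSurj := ⟨?_⟩ }⟩⟩
  · rintro Z W ⟨f, hf⟩
    change R.obj Z ⟶ R.obj W at f
    change R.map (L.map f) ≫ R.map (adj.counit.app W) = R.map (adj.counit.app Z) ≫ f at hf
    -- Since `f` is a morphism of free-presentation algebras `R Z ⟶ R W`, its transpose coequalises
    -- the canonical presentation of `Z`.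
    obtain ⟨k', hk'⟩ := hdesc (L.map f ≫ adj.counit.app W) (by
      have h₁ := adj.counit_naturality (L.map f)
      have h₂ := adj.counit_naturality (adj.counit.app W)
      dsimp only [Functor.id_obj, Functor.comp_obj] at h₁ h₂ ⊢
      rw [← L.map_comp_assoc, ← hf, L.map_comp, Category.assoc, h₂, ← Category.assoc, h₁,
        Category.assoc])
    refine ⟨k', ?_⟩
    ext
    change R.map k' = f
    rw [← Category.id_comp (R.map k'), ← adj.right_triangle_components, Category.assoc,
      ← R.map_comp, hk', R.map_comp, adj.unit_naturality_assoc, adj.right_triangle_components,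
      Category.comp_id]
  · rintro ⟨M, ξ, hunit, hassoc⟩
    change R.obj (L.obj M) ⟶ M at ξ
    change R.map (adj.counit.app (L.obj M)) ≫ ξ = R.map (L.map ξ) ≫ ξ at hassoc
    obtain ⟨Z, i, hq⟩ := hsurj M ξ hunit hassoc
    have hi : R.map (L.map i.hom) ≫ R.map (adj.counit.app Z) = ξ ≫ i.hom := by
      -- Transposing `hq` turns it into compatibility of `i` with the algebra structures.
      have h := congr(adj.unit.app _ ≫ R.map $hq)
      have h₁ : adj.unit.app (R.obj (L.obj M)) ≫ R.map (L.map ξ) = ξ ≫ adj.unit.app M :=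
        adj.unit_naturality ξ
      have h₂ : adj.unit.app M ≫ R.map (L.map i.hom) = i.hom ≫ adj.unit.app (R.obj Z) :=
        adj.unit_naturality i.hom
      simp only [R.map_comp, adj.right_triangle_components_assoc] at h
      rw [reassoc_of% h₁, reassoc_of% h₂, adj.right_triangle_components] at h
      exact h.symm.trans (congrArg (ξ ≫ ·) (Category.comp_id i.hom))
    exact ⟨Z, ⟨(Monad.Algebra.isoMk i hi).symm⟩⟩

end Monadicity

/-! ### Descent data and the axioms of an extension class -/

section ExtensionClass

variable {Y : Type u} [Category.{v} Y]

/-- A descent datum on `γ : D ⟶ X` relative to `e : X ⟶ B`: the object `P`, with projections `π₂`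
and `π₁`, is the pullback `D ×[B] X`, and `ξ` is an action of the kernel pair of `e` on `D`. -/
structure DescentDatum {X B D P : Y} (e : X ⟶ B) (γ : D ⟶ X) (π₂ : P ⟶ D) (π₁ : P ⟶ X)
    (ξ : P ⟶ D) : Prop where
  isPullback : IsPullback π₂ π₁ (γ ≫ e) e
  action_comp : ξ ≫ γ = π₁
  unit (s : D ⟶ P) : s ≫ π₂ = 𝟙 D → s ≫ π₁ = γ → s ≫ ξ = 𝟙 D
  assoc {T : Y} (x y z : T ⟶ P) :
    y ≫ π₂ = x ≫ ξ → z ≫ π₂ = x ≫ π₂ → z ≫ π₁ = y ≫ π₁ → y ≫ ξ = z ≫ ξ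

/-- A class of morphisms between the objects satisfying `O` that shares the formal properties of
the regular epimorphisms of a Barr exact category. -/
structure IsExtensionClass (O : ObjectProperty Y) (E : MorphismProperty Y) : Prop where
  dom {X Z : Y} {f : X ⟶ Z} : E f → O X
  cod {X Z : Y} {f : X ⟶ Z} : E f → O Z
  of_isIso {X Z : Y} (f : X ⟶ Z) [IsIso f] : O X → E f
  comp {X Z W : Y} {f : X ⟶ Z} {g : Z ⟶ W} : E f → E g → E (f ≫ g)
  hasPullback {X Z W : Y} (f : X ⟶ W) {g : Z ⟶ W} : E g → O X → HasPullback f g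
  baseChange {P X Z W : Y} {p : P ⟶ X} {q : P ⟶ Z} {f : X ⟶ W} {g : Z ⟶ W} :
    IsPullback p q f g → E g → O X → E p
  cancel {X Z W : Y} {f : X ⟶ Z} {g : Z ⟶ W} : E f → E (f ≫ g) → E g
  epi {X Z : Y} {f : X ⟶ Z} : E f → Epi f
  desc {X Z W R : Y} {f : X ⟶ Z} {p₁ p₂ : R ⟶ X} {k : X ⟶ W} :
    E f → IsPullback p₁ p₂ f f → p₁ ≫ k = p₂ ≫ k → ∃ k' : Z ⟶ W, f ≫ k' = k
  descent {X B D P : Y} {e : X ⟶ B} {γ : D ⟶ X} {π₂ : P ⟶ D} {π₁ : P ⟶ X} {ξ : P ⟶ D} :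
    E e → O D → DescentDatum e γ π₂ π₁ ξ →
      ∃ (A : Y) (q : D ⟶ A) (a : A ⟶ B), O A ∧ IsPullback q γ a e ∧ π₂ ≫ q = ξ ≫ q

/-- The kernel pair of the pullback `q` of `e` along `a` is the action associated with it. -/
theorem isPullback_action {X B D P A : Y} {e : X ⟶ B} {γ : D ⟶ X} {π₂ : P ⟶ D} {π₁ : P ⟶ X}
    {ξ : P ⟶ D} {q : D ⟶ A} {a : A ⟶ B} (hq : IsPullback q γ a e)
    (hP : IsPullback π₂ π₁ (γ ≫ e) e) (hξ : ξ ≫ γ = π₁) (h : π₂ ≫ q = ξ ≫ q) :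
    IsPullback π₂ ξ q q := by
  subst hξ
  rw [← hq.w] at hP
  exact (IsPullback.of_right hP.flip h.symm hq.flip).flip

section Map

variable {Z : Type*} [Category* Z]

/-- A descent datum is preserved by a functor preserving the pullbacks involved. -/
theorem DescentDatum.map {X B D P T : Y} {e : X ⟶ B} {γ : D ⟶ X} {π₂ : P ⟶ D} {π₁ : P ⟶ X}
    {ξ : P ⟶ D} (h : DescentDatum e γ π₂ π₁ ξ) (F : Y ⥤ Z) {x y : T ⟶ P}
    (hxy : x ≫ ξ = y ≫ π₂)
    (hP : IsPullback (F.map π₂) (F.map π₁) (F.map (γ ≫ e)) (F.map e))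
    (hT : IsPullback (F.map x) (F.map y) (F.map ξ) (F.map π₂)) :
    DescentDatum (F.map e) (F.map γ) (F.map π₂) (F.map π₁) (F.map ξ) where
  isPullback := by simpa using hP
  action_comp := by rw [← F.map_comp, h.action_comp]
  unit s h₂ h₁ := by
    let t : D ⟶ P := h.isPullback.lift (𝟙 D) γ (by simp)
    have hs : s = F.map t := hP.hom_ext (by simp [h₂, t, ← F.map_comp])
      (by simp [h₁, t, ← F.map_comp])
    rw [hs, ← F.map_comp, h.unit t (by simp [t]) (by simp [t]), F.map_id]
  assoc {T'} x' y' z' h₁ h₂ h₃ := by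
    -- Morphisms into `F.obj P` need not come from `Y`, so associativity is checked on the universal
    -- composable pair `x`, `y`, with composite `z`, and then transported by `F`.
    let z : T ⟶ P := h.isPullback.lift (x ≫ π₂) (y ≫ π₁) (by
      have := h.isPullback.w
      rw [Category.assoc, this, ← h.action_comp, Category.assoc, Category.assoc, reassoc_of% hxy, this,
        h.action_comp])
    let u : T' ⟶ F.obj T := hT.lift x' y' h₁.symm
    have hx : u ≫ F.map x = x' := by simp [u]
    have hy : u ≫ F.map y = y' := by simp [u]
    have hz : u ≫ F.map z = z' := hP.hom_ext
      (by rw [Category.assoc, ← F.map_comp, IsPullback.lift_fst, F.map_comp, reassoc_of% hx, h₂])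
      (by rw [Category.assoc, ← F.map_comp, IsPullback.lift_snd, F.map_comp, reassoc_of% hy, h₃])
    have := h.assoc x y z hxy.symm (by simp [z]) (by simp [z])
    rw [← hy, ← hz, Category.assoc, Category.assoc, ← F.map_comp, this, F.map_comp]

end Map

variable {O : ObjectProperty Y} {E : MorphismProperty Y}

namespace IsExtensionClass

/-- An extension class, viewed as a class of morphisms of the full subcategory on its objects, is
an extension class. -/
theorem fullSubcategory (h : IsExtensionClass O E) :
    IsExtensionClass (⊤ : ObjectProperty O.FullSubcategory) (E.inverseImage O.ι) := by
  have exists_pb : ∀ {X Z W : O.FullSubcategory} (f : X ⟶ W) {g : Z ⟶ W}, E g.hom →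
      ∃ (P : O.FullSubcategory) (p : P ⟶ X) (q : P ⟶ Z), IsPullback p q f g ∧
        IsPullback p.hom q.hom f.hom g.hom := by
    intro X Z W f g hg
    have := h.hasPullback f.hom hg X.property
    have hP := IsPullback.of_hasPullback f.hom g.hom
    refine ⟨⟨pullback f.hom g.hom, h.dom (h.baseChange hP hg X.property)⟩,
      ⟨pullback.fst f.hom g.hom⟩, ⟨pullback.snd f.hom g.hom⟩, ?_, hP⟩
    exact IsPullback.of_map_of_faithful O.ι hP
  -- Pullbacks along `E` computed in the ambient category stay in `O`, so uniqueness shows that the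
  -- inclusion preserves them.
  have map_pb : ∀ {P X Z W : O.FullSubcategory} {p : P ⟶ X} {q : P ⟶ Z} {f : X ⟶ W} {g : Z ⟶ W},
      IsPullback p q f g → E g.hom → IsPullback p.hom q.hom f.hom g.hom := by
    intro P X Z W p q f g hp hg
    obtain ⟨P', p', q', h', hP'⟩ := exists_pb f hg
    refine hP'.of_iso (O.ι.mapIso (hp.isoIsPullback X Z h').symm) (Iso.refl _) (Iso.refl _)
      (Iso.refl _) ?_ ?_ (by simp) (by simp)
    · have := congrArg O.ι.map (hp.isoIsPullback_inv_fst X Z h')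
      rw [O.ι.map_comp] at this
      exact (Category.comp_id _).trans this.symm
    · have := congrArg O.ι.map (hp.isoIsPullback_inv_snd X Z h')
      rw [O.ι.map_comp] at this
      exact (Category.comp_id _).trans this.symm
  refine ⟨fun _ => trivial, fun _ => trivial, ?_, ?_, ?_, ?_, ?_, ?_, ?_, ?_⟩
  · intro X Z f _ _
    exact h.of_isIso (O.ι.map f) X.property
  · intro X Z W f g hf hg
    exact h.comp hf hg
  · intro X Z W f g hg _
    obtain ⟨P, p, q, hp, -⟩ := exists_pb f hg
    exact hp.hasPullback
  · intro P X Z W p q f g hp hg _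
    exact h.baseChange (map_pb hp hg) hg X.property
  · intro X Z W f g hf hfg
    exact h.cancel hf hfg
  · intro X Z f hf
    have : Epi (O.ι.map f) := h.epi hf
    exact O.ι.epi_of_epi_map this
  · intro X Z W R f p₁ p₂ k hf hR hk
    obtain ⟨k', hk'⟩ := h.desc (k := k.hom) hf (map_pb hR hf) congr(($hk).hom)
    refine ⟨⟨k'⟩, ?_⟩
    ext
    exact hk'
  · intro X B D P e γ π₂ π₁ ξ he _ hd
    have hP := map_pb hd.isPullback he
    have hπ₂ := h.baseChange hP he D.property
    obtain ⟨T, x, y, hT, hT'⟩ := exists_pb ξ hπ₂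
    obtain ⟨A, q, a, hA, hq, hξ⟩ := h.descent he D.property (hd.map O.ι hT.w hP hT')
    refine ⟨⟨A, hA⟩, ⟨q⟩, ⟨a⟩, trivial, IsPullback.of_map_of_faithful O.ι hq, ?_⟩
    ext
    exact hξ

end IsExtensionClass

end ExtensionClass

/-! ### From extension classes to monadic pullback functors -/

section EffectiveDescent

variable {Y : Type u} [Category.{v} Y]

/-- An algebra structure for the monad induced by pulling back along `e` is a descent datum. -/
theorem descentDatum_of_algebra {X B D : Y} (e : X ⟶ B) (γ : D ⟶ X) [HasPullback (γ ≫ e) e]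
    [HasPullback (pullback.snd (γ ≫ e) e ≫ e) e] (ξ : pullback (γ ≫ e) e ⟶ D)
    (hξ : ξ ≫ γ = pullback.snd (γ ≫ e) e)
    (hunit : pullback.lift (𝟙 D) γ (Category.id_comp _) ≫ ξ = 𝟙 D)
    (m n : pullback (pullback.snd (γ ≫ e) e ≫ e) e ⟶ pullback (γ ≫ e) e)
    (hm₂ : m ≫ pullback.fst _ _ = pullback.fst _ _ ≫ pullback.fst _ _)
    (hm₁ : m ≫ pullback.snd _ _ = pullback.snd _ _)
    (hn₂ : n ≫ pullback.fst _ _ = pullback.fst _ _ ≫ ξ)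
    (hn₁ : n ≫ pullback.snd _ _ = pullback.snd _ _) (hassoc : m ≫ ξ = n ≫ ξ) :
    DescentDatum e γ (pullback.fst (γ ≫ e) e) (pullback.snd (γ ≫ e) e) ξ where
  isPullback := IsPullback.of_hasPullback _ _
  action_comp := hξ
  unit s h₂ h₁ := by
    rw [← hunit]
    congr 1
    apply pullback.hom_ext
    · rw [h₂, pullback.lift_fst]
    · rw [h₁, pullback.lift_snd]
  assoc {T} x y z h₁ h₂ h₃ := by
    let u : T ⟶ pullback (pullback.snd (γ ≫ e) e ≫ e) e :=
      pullback.lift x (y ≫ pullback.snd _ _) (by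
        rw [← hξ, Category.assoc, Category.assoc, ← reassoc_of% h₁, pullback.condition, hξ])
    have hy : u ≫ n = y := pullback.hom_ext
      (by rw [Category.assoc, hn₂, pullback.lift_fst_assoc, h₁])
      (by rw [Category.assoc, hn₁, pullback.lift_snd])
    have hz : u ≫ m = z := pullback.hom_ext
      (by rw [Category.assoc, hm₂, pullback.lift_fst_assoc, h₂])
      (by rw [Category.assoc, hm₁, pullback.lift_snd, h₃])
    rw [← hy, ← hz, Category.assoc, Category.assoc, hassoc]

namespace IsExtensionClass

variable {E : MorphismProperty Y}

/-- The pullback `q` of a morphism `e` in `E` along any morphism is the coequalizer of the two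
projections of the associated action. -/
theorem exists_desc_of_isPullback (h : IsExtensionClass (⊤ : ObjectProperty Y) E)
    {X B D P A W : Y} {e : X ⟶ B} {γ : D ⟶ X} {π₂ : P ⟶ D} {π₁ : P ⟶ X}
    {ξ : P ⟶ D} {q : D ⟶ A} {a : A ⟶ B} (he : E e) (hq : IsPullback q γ a e)
    (hP : IsPullback π₂ π₁ (γ ≫ e) e) (hξ : ξ ≫ γ = π₁) (hc : π₂ ≫ q = ξ ≫ q) {k : D ⟶ W}
    (hk : ξ ≫ k = π₂ ≫ k) : ∃ k' : A ⟶ W, q ≫ k' = k :=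
  h.desc (h.baseChange hq he trivial) (isPullback_action hq hP hξ hc) hk.symm

theorem hasPullbacksAlong (h : IsExtensionClass (⊤ : ObjectProperty Y) E) {X B : Y} {e : X ⟶ B}
    (he : E e) : HasPullbacksAlong e := fun g => h.hasPullback g he trivial

theorem isEffectiveDescent (h : IsExtensionClass (⊤ : ObjectProperty Y) E) {X B : Y} {e : X ⟶ B}
    (he : E e) : IsEffectiveDescent e := by
  have hpb : HasPullbacksAlong e := h.hasPullbacksAlong he
  refine ⟨hpb, nonempty_monadicRightAdjoint (Over.mapPullbackAdj e) ?_ ?_ ?_⟩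
  · intro A
    have : Epi (pullback.fst A.hom e) :=
      h.epi (h.baseChange (IsPullback.of_hasPullback A.hom e) he trivial)
    have : Epi ((Over.mapPullbackAdj e).counit.app A).left := by
      simpa using this
    exact Over.epi_of_epi_left _
  · intro A W k hk
    have hq := IsPullback.of_hasPullback A.hom e
    have : Epi (pullback.fst A.hom e) := h.epi (h.baseChange hq he trivial)
    have hk' := congr(($hk).left)
    simp at hk'
    obtain ⟨k', hk''⟩ := h.exists_desc_of_isPullback he hq
      (IsPullback.of_hasPullback (pullback.snd A.hom e ≫ e) e) (ξ := pullback.lift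
        (pullback.fst _ _ ≫ pullback.fst _ _) (pullback.snd _ _) (by simp [pullback.condition]))
      (pullback.lift_snd _ _ _) (pullback.lift_fst _ _ _).symm (k := k.left) hk'
    refine ⟨Over.homMk k' ?_, ?_⟩
    · rw [← cancel_epi (pullback.fst A.hom e), reassoc_of% hk'']
      simp [pullback.condition]
    · ext
      simpa using hk''
  · intro M ξ hunit hassoc
    have hd := descentDatum_of_algebra e M.hom ξ.left (Over.w ξ)
      (by simpa using congr(($hunit).left))
      (((Over.pullback e).map ((Over.mapPullbackAdj e).counit.app ((Over.map e).obj M))).left)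
      (((Over.pullback e).map ((Over.map e).map ξ)).left)
      (by simp; exact pullback.lift_fst _ _ _) (by simp; exact pullback.lift_snd _ _ _)
      (by simp; exact pullback.lift_fst _ _ _) (by simp; exact pullback.lift_snd _ _ _)
      congr(($hassoc).left)
    obtain ⟨A, q, a, -, hq, hξ⟩ := h.descent he trivial hd
    refine ⟨Over.mk a, Over.isoMk hq.isoPullback hq.isoPullback_hom_snd, ?_⟩
    ext
    simpa using hξ.symm

theorem isEffectiveRelDescent (h : IsExtensionClass (⊤ : ObjectProperty Y) E) {X B : Y} {e : X ⟶ B}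
    (he : E e) : IsEffectiveRelDescent E e := by
  have : HasPullbacksAlong e := h.hasPullbacksAlong he
  have hst : E.IsStableUnderBaseChangeAlong e :=
    ⟨fun hp hg => h.baseChange hp.flip hg trivial⟩
  have hcomp : E.IsStableUnderComposition := ⟨fun _ _ => h.comp⟩
  let adj := MorphismProperty.Over.mapPullbackAdj E ⊤ e he trivial
  refine ⟨fun k hk => h.comp hk he, inferInstance, hst, nonempty_monadicRightAdjoint adj ?_ ?_ ?_⟩
  · intro A
    have : Epi (pullback.fst A.hom e) :=
      h.epi (h.baseChange (IsPullback.of_hasPullback A.hom e) he trivial)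
    refine ⟨fun f g hfg => ?_⟩
    ext
    exact (cancel_epi (pullback.fst A.hom e)).1 congr(($hfg).left)
  · intro A W k hk
    have hq := IsPullback.of_hasPullback A.hom e
    have : Epi (pullback.fst A.hom e) := h.epi (h.baseChange hq he trivial)
    have hk' := congr(($hk).left)
    simp [adj] at hk'
    obtain ⟨k', hk''⟩ := h.exists_desc_of_isPullback he hq
      (IsPullback.of_hasPullback (pullback.snd A.hom e ≫ e) e) (ξ := pullback.lift
        (pullback.fst _ _ ≫ pullback.fst _ _) (pullback.snd _ _) (by simp [pullback.condition]))
      (pullback.lift_snd _ _ _) (pullback.lift_fst _ _ _).symm (k := k.left) hk'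
    refine ⟨MorphismProperty.Over.homMk k' ?_, ?_⟩
    · rw [← cancel_epi (pullback.fst A.hom e), reassoc_of% hk'', pullback.condition]
      exact MorphismProperty.Over.w k
    · ext
      exact hk''
  · intro M ξ hunit hassoc
    let γ : M.left ⟶ X := M.hom
    let ζ : pullback (γ ≫ e) e ⟶ M.left := ξ.left
    have hζ : ζ ≫ γ = pullback.snd (γ ≫ e) e := MorphismProperty.Over.w ξ
    have hd := descentDatum_of_algebra e γ ζ hζ
      congr(($hunit).left)
      (pullback.lift (pullback.fst _ _ ≫ pullback.fst _ _) (pullback.snd _ _)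
        (by rw [Category.assoc, pullback.condition, pullback.condition]))
      (pullback.lift (pullback.fst _ _ ≫ ζ) (pullback.snd _ _)
        (by rw [Category.assoc, reassoc_of% hζ, pullback.condition]))
      (pullback.lift_fst _ _ _) (pullback.lift_snd _ _ _)
      (pullback.lift_fst _ _ _) (pullback.lift_snd _ _ _)
      congr(($hassoc).left)
    obtain ⟨A, q, a, -, hq, hc⟩ := h.descent he trivial hd
    -- The descended morphism stays in `E` because `q ≫ a = γ ≫ e` with `q`, `γ` and `e` in `E`;
    -- this is where right cancellation enters.
    have ha : E a := h.cancel (h.baseChange hq he trivial) (by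
      rw [hq.w]
      exact h.comp M.prop he)
    refine ⟨MorphismProperty.Over.mk ⊤ a ha,
      MorphismProperty.Over.isoMk hq.isoPullback hq.isoPullback_hom_snd, ?_⟩
    ext
    change ζ ≫ hq.isoPullback.hom ≫ pullback.fst a e =
      pullback.fst (γ ≫ e) e ≫ hq.isoPullback.hom ≫ pullback.fst a e
    rw [hq.isoPullback_hom_fst]
    exact hc.symm

end IsExtensionClass
end EffectiveDescent

/-! ### The base case: regular epimorphisms in a Barr exact category -/

section Regular

variable {C : Type u} [Category.{v} C]

theorem isRegularEpi_of_strongEpi [Regular C] {X Z : C} (f : X ⟶ Z) [StrongEpi f] :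
    IsRegularEpi f := inferInstance

/-- Descent data along a morphism of a category with pullbacks are equivalence relations. -/
theorem DescentDatum.isEquivalenceRelation [HasPullbacks C] {X B D P : C} {e : X ⟶ B} {γ : D ⟶ X}
    {π₂ : P ⟶ D} {π₁ : P ⟶ X} {ξ : P ⟶ D} (h : DescentDatum e γ π₂ π₁ ξ) :
    IsEquivalenceRelation π₂ ξ := by
  have hw := h.isPullback.w
  have hξ := h.action_comp
  let r : D ⟶ P := h.isPullback.lift (𝟙 D) γ (by simp)
  have hr : r ≫ ξ = 𝟙 D := h.unit r (by simp [r]) (by simp [r])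
  -- On elements, `s (d, x) = (ξ (d, x), γ d)`; associativity and the unit law give `ξ (s (d, x)) =
  -- ξ (d, γ d) = d`.
  let s : P ⟶ P := h.isPullback.lift ξ (π₂ ≫ γ) (by rw [reassoc_of% hξ, Category.assoc, hw])
  have hs : s ≫ ξ = π₂ := by
    rw [h.assoc (𝟙 P) s (π₂ ≫ r) (by simp [s]) (by simp [r]) (by simp [r, s]), Category.assoc, hr,
      Category.comp_id]
  let x : pullback ξ π₂ ⟶ P := pullback.fst ξ π₂
  let y : pullback ξ π₂ ⟶ P := pullback.snd ξ π₂
  have hxy : x ≫ ξ = y ≫ π₂ := pullback.condition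
  let t : pullback ξ π₂ ⟶ P := h.isPullback.lift (x ≫ π₂) (y ≫ π₁) (by
    rw [Category.assoc, Category.assoc, hw, ← hξ, Category.assoc, reassoc_of% hxy, hw, reassoc_of% hξ])
  have ht : y ≫ ξ = t ≫ ξ := h.assoc x y t hxy.symm (by simp [t]) (by simp [t])
  refine ⟨⟨{
    right_cancellation := fun T a b h₂ h₁ => h.isPullback.hom_ext h₂ (by
      rw [← hξ, reassoc_of% h₁])
    r := r
    reflexivity₁ := by simp [r]
    reflexivity₂ := hr
    s := s
    symmetry₁ := by simp [s]
    symmetry₂ := hs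
    c := _
    isLimit := pullbackIsPullback ξ π₂
    t := t
    transitivity₁ := h.isPullback.lift_fst _ _ _
    transitivity₂ := ht.symm }⟩⟩

/-- Regular epimorphisms in a Barr exact category admit descent. -/
theorem BarrExact.exists_descent [BarrExact C] {X B D P : C} {e : X ⟶ B} {γ : D ⟶ X}
    {π₂ : P ⟶ D} {π₁ : P ⟶ X} {ξ : P ⟶ D} (h : DescentDatum e γ π₂ π₁ ξ) :
    ∃ (A : C) (q : D ⟶ A) (a : A ⟶ B), IsPullback q γ a e ∧ π₂ ≫ q = ξ ≫ q := by
  have := h.isEquivalenceRelation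
  have hw := h.isPullback.w
  have hξ := h.action_comp
  obtain ⟨⟨ε⟩⟩ := BarrExact.effective π₂ ξ
  obtain ⟨a, ha⟩ : ∃ a : ε.B ⟶ B, ε.π ≫ a = γ ≫ e :=
    ⟨ε.isPushout.desc (γ ≫ e) (γ ≫ e) (by rw [hw, reassoc_of% hξ]), by simp⟩
  have hq : π₂ ≫ ε.π = ξ ≫ ε.π := ε.isPushout.w
  let A' := pullback a e
  let m : D ⟶ A' := pullback.lift ε.π γ ha
  have hm₁ : m ≫ pullback.fst a e = ε.π := pullback.lift_fst _ _ _
  have hm₂ : m ≫ pullback.snd a e = γ := pullback.lift_snd _ _ _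
  -- Elements with the same class in the quotient are related by some `z`; having also the same
  -- image under `γ`, they force `z` to be reflexive.
  have : Mono m := ⟨fun {T} d d' hd => by
    have h₁ : d ≫ γ = d' ≫ γ := by rw [← hm₂, reassoc_of% hd]
    let z : T ⟶ P := ε.isKernelPair.lift d d' (by rw [← hm₁, reassoc_of% hd])
    have hz₁ : z ≫ π₂ = d := by simp [z]
    have hz₂ : z ≫ ξ = d' := by simp [z]
    let r : D ⟶ P := h.isPullback.lift (𝟙 D) γ (by simp)
    have hr : r ≫ ξ = 𝟙 D := h.unit r (by simp [r]) (by simp [r])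
    have : z = d ≫ r := h.isPullback.hom_ext (by simp [r, hz₁])
      (by simp [r, ← hξ, reassoc_of% hz₂, h₁])
    rw [← hz₂, this, Category.assoc, hr, Category.comp_id]⟩
  -- Both sides compute `D ×[B] X`, so `ξ ≫ m` is a base change of the quotient map. Hence `m` is a
  -- strong epimorphism, and being mono it is invertible.
  have hsq : IsPullback (ξ ≫ m) π₂ (pullback.fst a e) ε.π := by
    have hR : IsPullback π₁ π₂ e (ε.π ≫ a) := by
      rw [ha]
      exact h.isPullback.flip
    have : ξ ≫ m ≫ pullback.snd a e = π₁ := by rw [hm₂, hξ]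
    refine IsPullback.of_right (h₁₂ := pullback.snd a e) (h₂₂ := a) (v₁₃ := e) ?_ ?_
      (IsPullback.of_hasPullback a e).flip
    · rwa [Category.assoc, this]
    · rw [Category.assoc, hm₁, hq]
  have h₁ : IsRegularEpi (ξ ≫ m) :=
    Regular.regularEpiIsStableUnderBaseChange.of_isPullback hsq.flip
      (show IsRegularEpi ε.π from inferInstance)
  have : StrongEpi m := strongEpi_of_strongEpi ξ m
  have : IsIso m := isIso_of_mono_of_strongEpi m
  refine ⟨ε.B, ε.π, a, ?_, hq⟩
  exact IsPullback.of_iso_pullback ⟨ha⟩ (asIso m) hm₁ hm₂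

theorem isExtensionClass_regularEpi [BarrExact C] :
    IsExtensionClass (fun _ : C => True) (MorphismProperty.regularEpi C) where
  dom _ := trivial
  cod _ := trivial
  of_isIso f _ _ := show IsRegularEpi f from inferInstance
  comp {X Z W f g} hf hg := by
    have : IsRegularEpi f := hf
    have : IsRegularEpi g := hg
    have : StrongEpi (f ≫ g) := inferInstance
    exact isRegularEpi_of_strongEpi _
  hasPullback _ _ _ _ := inferInstance
  baseChange hp hg _ := Regular.regularEpiIsStableUnderBaseChange.of_isPullback hp.flip hg
  cancel {X Z W f g} _ hfg := by
    have : IsRegularEpi (f ≫ g) := hfg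
    have : StrongEpi g := strongEpi_of_strongEpi f g
    exact isRegularEpi_of_strongEpi _
  epi {X Z f} hf := by
    have : IsRegularEpi f := hf
    infer_instance
  desc {X Z W R f p₁ p₂ k} hf hp hk := by
    have : IsRegularEpi f := hf
    let l : IsRegularEpi.W f ⟶ R := hp.lift (IsRegularEpi.left f) (IsRegularEpi.right f)
      (IsRegularEpi.w f)
    have h₁ : l ≫ p₁ = IsRegularEpi.left f := by simp [l]
    have h₂ : l ≫ p₂ = IsRegularEpi.right f := by simp [l]
    exact ⟨IsRegularEpi.desc f k (by rw [← h₁, ← h₂, Category.assoc, hk, Category.assoc]),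
      IsRegularEpi.fac f k _⟩
  descent _ _ hd := by
    obtain ⟨A, q, a, hq, hξ⟩ := BarrExact.exists_descent hd
    exact ⟨A, q, a, trivial, hq, hξ⟩

end Regular

/-! ### Componentwise pullbacks in arrow categories -/

section ArrowPullback

variable {Y : Type u} [Category.{v} Y]

/-- A square in the arrow category is a pullback as soon as its components are. -/
theorem isPullback_arrow {P X Z W : Arrow Y} {p : P ⟶ X} {q : P ⟶ Z} {f : X ⟶ W} {g : Z ⟶ W}
    (hl : IsPullback p.left q.left f.left g.left)
    (hr : IsPullback p.right q.right f.right g.right) : IsPullback p q f g where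
  w := by
    ext
    · exact hl.w
    · exact hr.w
  isLimit' := ⟨PullbackCone.IsLimit.mk _
    (fun s => Arrow.homMk
      (hl.lift s.fst.left s.snd.left congr(($s.condition).left))
      (hr.lift s.fst.right s.snd.right congr(($s.condition).right))
      (hr.hom_ext
        (by rw [Category.assoc, ← Arrow.w p, hl.lift_fst_assoc, Category.assoc, hr.lift_fst,
          Arrow.w])
        (by rw [Category.assoc, ← Arrow.w q, hl.lift_snd_assoc, Category.assoc, hr.lift_snd,
          Arrow.w])))
    (fun s => by ext <;> simp) (fun s => by ext <;> simp)
    (fun s m h₁ h₂ => by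
      ext
      · exact hl.hom_ext (by simp [← h₁]) (by simp [← h₂])
      · exact hr.hom_ext (by simp [← h₁]) (by simp [← h₂]))⟩

theorem exists_isPullback_arrow [HasPullbacks Y] {X Z W : Arrow Y} (f : X ⟶ W) (g : Z ⟶ W) :
    ∃ (P : Arrow Y) (p : P ⟶ X) (q : P ⟶ Z), IsPullback p q f g ∧
      IsPullback p.left q.left f.left g.left ∧ IsPullback p.right q.right f.right g.right := by
  let h : pullback f.left g.left ⟶ pullback f.right g.right :=
    pullback.map _ _ _ _ X.hom Z.hom W.hom (by simp) (by simp)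
  let p : Arrow.mk h ⟶ X := Arrow.homMk (pullback.fst _ _) (pullback.fst _ _)
    (pullback.lift_fst _ _ _).symm
  let q : Arrow.mk h ⟶ Z := Arrow.homMk (pullback.snd _ _) (pullback.snd _ _)
    (pullback.lift_snd _ _ _).symm
  have hl : IsPullback p.left q.left f.left g.left := IsPullback.of_hasPullback _ _
  have hr : IsPullback p.right q.right f.right g.right := IsPullback.of_hasPullback _ _
  exact ⟨_, p, q, isPullback_arrow hl hr, hl, hr⟩

instance preservesPullbacks_leftFunc [HasPullbacks Y] :
    PreservesLimitsOfShape WalkingCospan (Arrow.leftFunc : Arrow Y ⥤ Y) :=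
  preservesLimitsOfShape_walkingCospan_of_forall_isPullback fun _ _ _ f g _ => by
    obtain ⟨P, p, q, h, hl, -⟩ := exists_isPullback_arrow f g
    exact ⟨P, p, q, h, hl⟩

instance preservesPullbacks_rightFunc [HasPullbacks Y] :
    PreservesLimitsOfShape WalkingCospan (Arrow.rightFunc : Arrow Y ⥤ Y) :=
  preservesLimitsOfShape_walkingCospan_of_forall_isPullback fun _ _ _ f g _ => by
    obtain ⟨P, p, q, h, -, hr⟩ := exists_isPullback_arrow f g
    exact ⟨P, p, q, h, hr⟩

end ArrowPullback

/-! ### The inductive step: double extensions form an extension class -/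

namespace IsExtensionClass

section Arrow

variable {Y : Type u} [Category.{v} Y] {O : ObjectProperty Y} {E : MorphismProperty Y}

theorem doubleExtension_of_isPullback (h : IsExtensionClass O E) {f g : Arrow Y} {α : f ⟶ g}
    (hf : E f.hom) (hg : E g.hom) (hl : E α.left) (hr : E α.right) {P : Y} {π₁ : P ⟶ f.right}
    {π₂ : P ⟶ g.left} {p : f.left ⟶ P} (hP : IsPullback π₁ π₂ α.right g.hom)
    (h₁ : p ≫ π₁ = f.hom) (h₂ : p ≫ π₂ = α.left) (hp : E p) : doubleExtension E α :=
  ⟨hf, hg, hl, hr, P, π₁, π₂, p, hP, h₁, h₂, h.baseChange hP hg (h.cod hf),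
    h.baseChange hP.flip hr (h.dom hg), hp⟩

theorem doubleExtension_of_isIso (h : IsExtensionClass O E) {f g : Arrow Y} (α : f ⟶ g) [IsIso α]
    (hf : E f.hom) : doubleExtension E α := by
  have hl : E α.left := h.of_isIso _ (h.dom hf)
  have hr : E α.right := h.of_isIso _ (h.cod hf)
  have hg : E g.hom := h.cancel hl (by
    rw [Arrow.w]
    exact h.comp hf hr)
  have := h.hasPullback α.right hg (h.cod hf)
  have hP := IsPullback.of_hasPullback α.right g.hom
  let p : f.left ⟶ pullback α.right g.hom := pullback.lift f.hom α.left (Arrow.w α).symm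
  have hp : p ≫ pullback.snd _ _ = α.left := pullback.lift_snd _ _ _
  have : IsIso (pullback.snd α.right g.hom) := hP.isIso_snd_of_isIso
  have : IsIso p := by
    have : IsIso (p ≫ pullback.snd α.right g.hom) := hp ▸ inferInstance
    exact IsIso.of_isIso_comp_right p (pullback.snd α.right g.hom)
  exact h.doubleExtension_of_isPullback hf hg hl hr hP (pullback.lift_fst _ _ _) hp
    (h.of_isIso p (h.dom hf))

/-- The comparison map of the composite is that of `α` followed by a base change of that of `β`. -/
theorem doubleExtension_comp (h : IsExtensionClass O E) {f g k : Arrow Y} {α : f ⟶ g} {β : g ⟶ k}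
    (hα : doubleExtension E α) (hβ : doubleExtension E β) : doubleExtension E (α ≫ β) := by
  obtain ⟨hf, hg, hl, hr, P, π₁, π₂, p, hP, hp₁, hp₂, -, -, hp⟩ := hα
  obtain ⟨-, hk, hl', hr', Q, ρ₁, ρ₂, q, hQ, hq₁, hq₂, hρ₁, hρ₂, hq⟩ := hβ
  have := h.hasPullback α.right hρ₁ (h.cod hf)
  have hR := IsPullback.of_hasPullback α.right ρ₁
  have hσ := h.baseChange hR hρ₁ (h.cod hf)
  let c : P ⟶ pullback α.right ρ₁ := pullback.lift π₁ (π₂ ≫ q) (by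
    rw [Category.assoc, hq₁, hP.w])
  have hc₁ : c ≫ pullback.fst α.right ρ₁ = π₁ := pullback.lift_fst _ _ _
  have hc₂ : c ≫ pullback.snd α.right ρ₁ = π₂ ≫ q := pullback.lift_snd _ _ _
  have hc : IsPullback c π₂ (pullback.snd α.right ρ₁) q :=
    IsPullback.of_right (by rw [hc₁, hq₁]; exact hP) hc₂ hR
  refine h.doubleExtension_of_isPullback hf hk (h.comp hl hl') (h.comp hr hr')
    (hR.flip.paste_horiz hQ.flip).flip (p := p ≫ c) ?_ ?_
    (h.comp hp (h.baseChange hc hq (h.dom hσ)))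
  · rw [Category.assoc, hc₁, hp₁]
  · rw [Category.assoc, reassoc_of% hc₂, hq₂, reassoc_of% hp₂, Arrow.comp_left]

/-- The comparison map of `α ≫ β`, followed by a base change `c` of `α.right`, equals `α.left`
followed by the comparison map `q` of `β`; cancelling `α.left` leaves `q` in `E`. -/
theorem doubleExtension_cancel (h : IsExtensionClass O E) {f g k : Arrow Y} {α : f ⟶ g} {β : g ⟶ k}
    (hα : doubleExtension E α) (hβ : doubleExtension E (α ≫ β)) : doubleExtension E β := by
  obtain ⟨hf, hg, hl, hr, -⟩ := hα
  obtain ⟨-, hk, hl', hr', R, σ₁, σ₂, r, hR, hr₁, hr₂, -, -, hrE⟩ := hβ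
  have hβr : E β.right := h.cancel hr hr'
  have := h.hasPullback β.right hk (h.dom hβr)
  have hQ := IsPullback.of_hasPullback β.right k.hom
  have hρ := h.baseChange hQ hk (h.dom hβr)
  let q : g.left ⟶ pullback β.right k.hom := pullback.lift g.hom β.left (Arrow.w β).symm
  let c : R ⟶ pullback β.right k.hom := pullback.lift (σ₁ ≫ α.right) σ₂ (by
    simpa using hR.w)
  have hc₁ : c ≫ pullback.fst β.right k.hom = σ₁ ≫ α.right := pullback.lift_fst _ _ _
  have hc₂ : c ≫ pullback.snd β.right k.hom = σ₂ := pullback.lift_snd _ _ _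
  have hc : IsPullback c σ₁ (pullback.fst β.right k.hom) α.right :=
    IsPullback.of_right (by rw [hc₂]; exact hR.flip) hc₁ hQ.flip
  have hrc : r ≫ c = α.left ≫ q := pullback.hom_ext
    (by
      rw [Category.assoc, hc₁, Category.assoc, pullback.lift_fst, reassoc_of% hr₁, Arrow.w])
    (by rw [Category.assoc, hc₂, Category.assoc, pullback.lift_snd, hr₂, Arrow.comp_left])
  refine h.doubleExtension_of_isPullback hg hk (h.cancel hl hl') hβr hQ
    (pullback.lift_fst _ _ _) (pullback.lift_snd _ _ _) (p := q) (h.cancel hl ?_)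
  rw [← hrc]
  exact h.comp hrE (h.baseChange hc hr (h.dom hρ))

/-- The comparison map of `p` is a base change of that of `g`. Composed with a base change of
`X.hom` it gives `P.hom`, so `P` is again an extension. -/
theorem doubleExtension_baseChange (h : IsExtensionClass O E) {P X Z W : Arrow Y} {p : P ⟶ X}
    {q : P ⟶ Z} {f : X ⟶ W} {g : Z ⟶ W} (hpl : IsPullback p.left q.left f.left g.left)
    (hpr : IsPullback p.right q.right f.right g.right) (hg : doubleExtension E g)
    (hX : E X.hom) : doubleExtension E p := by
  obtain ⟨hZ, hW, hl, hr, Q, ρ₁, ρ₂, r, hQ, hr₁, hr₂, -, -, hrE⟩ := hg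
  have hpE : E p.right := h.baseChange hpr hr (h.cod hX)
  have := h.hasPullback p.right hX (h.dom hpE)
  have hS := IsPullback.of_hasPullback p.right X.hom
  have hσ := h.baseChange hS hX (h.dom hpE)
  let t : pullback p.right X.hom ⟶ Q :=
    hQ.lift (pullback.fst _ _ ≫ q.right) (pullback.snd _ _ ≫ f.left) (by
      rw [Category.assoc, ← hpr.w, pullback.condition_assoc, Category.assoc, Arrow.w])
  have ht₁ : t ≫ ρ₁ = pullback.fst _ _ ≫ q.right := hQ.lift_fst _ _ _
  have ht₂ : t ≫ ρ₂ = pullback.snd _ _ ≫ f.left := hQ.lift_snd _ _ _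
  let c : P.left ⟶ pullback p.right X.hom := pullback.lift P.hom p.left (Arrow.w p).symm
  have hc₁ : c ≫ pullback.fst _ _ = P.hom := pullback.lift_fst _ _ _
  have hc₂ : c ≫ pullback.snd _ _ = p.left := pullback.lift_snd _ _ _
  have hST : IsPullback t (pullback.snd p.right X.hom) ρ₂ f.left :=
    IsPullback.of_right (h₁₂ := ρ₁) (h₂₂ := W.hom) (v₁₃ := g.right)
      (by
        rw [ht₁, Arrow.w]
        exact hS.paste_horiz hpr.flip) ht₂ hQ
  have hcr : IsPullback c q.left t r := by
    refine (IsPullback.of_bot (h₃₁ := f.left) (v₂₁ := pullback.snd _ _) (v₂₂ := ρ₂)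
      ?_ ?_ hST).flip
    · rw [hc₂, hr₂]
      exact hpl.flip
    · refine hQ.hom_ext ?_ ?_
      · rw [Category.assoc, hr₁, Category.assoc, ht₁, reassoc_of% hc₁, Arrow.w]
      · rw [Category.assoc, hr₂, Category.assoc, ht₂, reassoc_of% hc₂, hpl.w]
  have hcE : E c := h.baseChange hcr hrE (h.dom hσ)
  have hP : E P.hom := by
    rw [← hc₁]
    exact h.comp hcE hσ
  exact h.doubleExtension_of_isPullback hP hX (h.baseChange hpl hl (h.dom hX)) hpE hS hc₁ hc₂ hcE

theorem arrow [HasPullbacks Y] (h : IsExtensionClass O E) :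
    IsExtensionClass (fun f : Arrow Y => E f.hom) (doubleExtension E) where
  dom hf := hf.1
  cod hf := hf.2.1
  of_isIso f _ hf := h.doubleExtension_of_isIso f hf
  comp := h.doubleExtension_comp
  hasPullback f g _ _ := (exists_isPullback_arrow f g).elim
    fun _ ⟨_, _, hp, _⟩ => hp.hasPullback
  baseChange hp hg hX := h.doubleExtension_baseChange
    (hp.map Arrow.leftFunc) (hp.map Arrow.rightFunc) hg hX
  cancel := h.doubleExtension_cancel
  epi {X Z f} hf := by
    have := h.epi hf.2.2.1
    have := h.epi hf.2.2.2.1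
    refine ⟨fun a b hab => ?_⟩
    ext
    · exact (cancel_epi f.left).1 congr(($hab).left)
    · exact (cancel_epi f.right).1 congr(($hab).right)
  desc {X Z W R f p₁ p₂ k} hf hp hk := by
    obtain ⟨kl, hkl⟩ := h.desc hf.2.2.1 (hp.map Arrow.leftFunc) congr(($hk).left)
    obtain ⟨kr, hkr⟩ := h.desc hf.2.2.2.1 (hp.map Arrow.rightFunc) congr(($hk).right)
    have := h.epi hf.2.2.1
    refine ⟨Arrow.homMk kl kr ?_, ?_⟩
    · rw [← cancel_epi f.left, reassoc_of% hkl, ← Category.assoc f.left, Arrow.w f,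
        Category.assoc]
      exact (Arrow.w k).trans congr(X.hom ≫ $hkr.symm)
    · ext
      · exact hkl
      · exact hkr
  descent {X B D P e γ π₂ π₁ ξ} he hD hd := by
    obtain ⟨T, x, y, hT, -⟩ := exists_isPullback_arrow ξ π₂
    have hl : DescentDatum e.left γ.left π₂.left π₁.left ξ.left :=
      hd.map Arrow.leftFunc hT.w (hd.isPullback.map _) (hT.map _)
    have hr : DescentDatum e.right γ.right π₂.right π₁.right ξ.right :=
      hd.map Arrow.rightFunc hT.w (hd.isPullback.map _) (hT.map _)
    obtain ⟨A, q, a, hA, hq, hξ⟩ := h.descent he.2.2.1 (h.dom hD) hl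
    -- The two components descend independently; `m` below is induced because `q` is the coequaliser
    -- of the action on domains.
    obtain ⟨A', q', a', hA', hq', hξ'⟩ := h.descent he.2.2.2.1 (h.cod hD) hr
    have hqE : E q := h.baseChange hq he.2.2.1 hA
    have hqE' : E q' := h.baseChange hq' he.2.2.2.1 hA'
    have := h.epi hqE
    obtain ⟨m, hm⟩ := h.desc (k := D.hom ≫ q') hqE
      (isPullback_action hq hl.isPullback hl.action_comp hξ) (by
        have h₁ := Arrow.w π₂
        have h₂ := Arrow.w ξ
        rw [reassoc_of% h₁, reassoc_of% h₂, hξ'])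
    have hmE : E m := h.cancel hqE (by
      rw [hm]
      exact h.comp hD hqE')
    let φ : D ⟶ Arrow.mk m := Arrow.homMk q q' hm
    have hψ : a ≫ B.hom = m ≫ a' := by
      have h₁ := Arrow.w e
      have h₂ := Arrow.w γ
      have h₃ := hq.w
      have h₄ := hq'.w
      rw [← cancel_epi q, reassoc_of% h₃, reassoc_of% hm, h₄, h₁, reassoc_of% h₂]
    let ψ : Arrow.mk m ⟶ B := Arrow.homMk a a' hψ
    refine ⟨Arrow.mk m, φ, ψ, hmE, isPullback_arrow hq hq', ?_⟩
    ext
    · exact hξ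
    · exact hξ'

end Arrow

end IsExtensionClass

/-! ### Induction along the tower -/

section TowerDescent

variable (C : Type (max u v)) [Category.{v} C] [BarrExact C]

theorem hasPullbacks_hArr : ∀ n : ℕ, HasPullbacks (HArr.{v, u} C n)
  | 0 => inferInstanceAs (HasPullbacks C)
  | n + 1 => by
    have := hasPullbacks_hArr n
    exact inferInstanceAs (HasPullbacks (Arrow (HArr.{v, u} C n)))

theorem isExtensionClass_extClass :
    ∀ n : ℕ, IsExtensionClass (isExt.{v, u} C n) (extClass.{v, u} C n)
  | 0 => isExtensionClass_regularEpi (C := C)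
  | n + 1 => by
    have := hasPullbacks_hArr.{v, u} C n
    exact (isExtensionClass_extClass n).arrow

end TowerDescent

end HigherExt

theorem mainTheorem7 (C : Type (max u v)) [Category.{v} C] [HigherExt.BarrExact C] (n : ℕ)
    {X B : HigherExt.ExtCat.{v, u} C n} (e : X ⟶ B) (he : HigherExt.ext.{v, u} C n e) :
    HigherExt.IsEffectiveDescent e ∧
      HigherExt.IsEffectiveRelDescent (HigherExt.ext.{v, u} C n) e := by
  have h := (HigherExt.isExtensionClass_extClass.{v, u} C n).fullSubcategory
  exact ⟨h.isEffectiveDescent he, h.isEffectiveRelDescent he⟩
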